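/- Consider the linear time-invariant plant $x_{t+1}=Ax_t+B_uu_t+B_ww_t$, $t=0,1,2,\dots$, with real matrices and $x_t\in\mathbb R^{n_x}$, $u_t\in\mathbb R^{n_u}$, $w_t\in\mathbb R^{n_w}$. Assume that $A$ is nonsingular, $(A,B_u)$ is stabilizable, $Q\succeq 0$, $R\succ 0$, and $(A,Q)$ is detectable. Let $P\succeq 0$ be the (stabilizing) solution of the discrete-time algebraic Riccati equation $$0=P-A^\top PA-Q+A^\top PB_uH^{-1}B_u^\top PA,\qquad H:=R+B_u^\top PB_u,$$ and put $K_x:=H^{-1}B_u^\top PA$, $K_w:=H^{-1}B_u^\top PB_w$, $K_v:=H^{-1}B_u^\top$, $\hat A:=A-B_uK_x$. Let $w=(w_t)_{t\ge 0}\in\ell_2$ be any deterministic disturbance. Then: 1. There is exactly one sequence $(v^{nc}_t)_{t\ge0}$ with $v^{nc}_t=\hat A^\top(v^{nc}_{t+1}+PB_ww_t)$ for all $t\ge0$ and $\lim_{t\to\infty}v^{nc}_t=0$, and it satisfies, for all $t\ge 0$, $$v^{nc}_{t+1}=\sum_{j=t+1}^{\infty}(\hat A^\top)^{j-t}PB_ww_j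 .$$ 2. The optimal noncausal controller is $u^{nc}_t=-K_xx_t-K_ww_t-K_vv^{nc}_{t+1}$. That is, this controller keeps the state bounded for every initial condition, and for every $x_0$ it has finite cost $\sum_{t=0}^\infty \left(x_t^\top Qx_t+u_t^\top Ru_t\right)$, which is minimal among all deterministic policies whose input at time $t$ may depend on $x_0,\dots,x_t$ and on the whole sequence $w$; every policy that attains the minimum generates the same input sequence. 3. For $p\ge 0$ let $u^p_t=-K_xx_t-K_ww_t-K_vv^p_{t+1}$ with $v^p_{t+1}=\sum_{j=t+1}^{t+p}(\hat A^\top)^{j-t}PB_ww_j$ be the controller with $p$ steps of preview. For every initial condition $x_0$, let $u^{nc}_t$ and $u^p_t$ denote the inputs generated by the two controllers, each along its own closed-loop trajectory started at $x_0$ and driven by $w$. Then $\|u^{nc}_t-u^p_t\|_2\to0$ uniformly in $t\ge0$ as $p\to\infty$. -/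

import Mathlib

open Filter Topology Matrix

/-- A real square matrix is Schur if the spectral radius of its complexification is `< 1`. -/
def Matrix.IsSchur {n : ℕ} (M : Matrix (Fin n) (Fin n) ℝ) : Prop :=
  spectralRadius ℂ (M.map (algebraMap ℝ ℂ)) < 1

/-- The pair `(A, B)` is stabilizable. -/
def Matrix.IsStabilizablePair {n m : ℕ} (A : Matrix (Fin n) (Fin n) ℝ)
    (B : Matrix (Fin n) (Fin m) ℝ) : Prop :=
  ∃ F : Matrix (Fin m) (Fin n) ℝ, (A + B * F).IsSchur

/-- The pair `(A, C)` is detectable. -/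
def Matrix.IsDetectablePair {n m : ℕ} (A : Matrix (Fin n) (Fin n) ℝ)
    (C : Matrix (Fin m) (Fin n) ℝ) : Prop :=
  ∃ L : Matrix (Fin n) (Fin m) ℝ, (A + L * C).IsSchur

/-- The matrices of the plant `x (t+1) = A x t + Bu u t + Bw w t` and of the stage cost
`xᵀ Q x + uᵀ R u`. -/
structure LQRData (nx nu nw : ℕ) where
  A : Matrix (Fin nx) (Fin nx) ℝ
  Bu : Matrix (Fin nx) (Fin nu) ℝ
  Bw : Matrix (Fin nx) (Fin nw) ℝ
  Q : Matrix (Fin nx) (Fin nx) ℝ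
  R : Matrix (Fin nu) (Fin nu) ℝ

namespace LQRData

variable {nx nu nw : ℕ} (D : LQRData nx nu nw)

/-- The standing assumptions of the infinite-horizon problem. -/
structure Standing : Prop where
  nonsingular : IsUnit D.A
  stabilizable : D.A.IsStabilizablePair D.Bu
  detectable : D.A.IsDetectablePair D.Q
  posSemidef_Q : D.Q.PosSemidef
  posDef_R : D.R.PosDef

/-- `H = R + Buᵀ P Bu`. -/
def H (P : Matrix (Fin nx) (Fin nx) ℝ) : Matrix (Fin nu) (Fin nu) ℝ :=
  D.R + D.Buᵀ * P * D.Bu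

/-- `P ⪰ 0` solves the discrete-time algebraic Riccati equation. -/
structure IsDARESolution (P : Matrix (Fin nx) (Fin nx) ℝ) : Prop where
  posSemidef : P.PosSemidef
  dare : 0 = P - D.Aᵀ * P * D.A - D.Q + D.Aᵀ * P * D.Bu * (D.H P)⁻¹ * D.Buᵀ * P * D.A

/-- `Kx = H⁻¹ Buᵀ P A`. -/
noncomputable def Kx (P : Matrix (Fin nx) (Fin nx) ℝ) : Matrix (Fin nu) (Fin nx) ℝ :=
  (D.H P)⁻¹ * D.Buᵀ * P * D.A

/-- `Kw = H⁻¹ Buᵀ P Bw`. -/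
noncomputable def Kw (P : Matrix (Fin nx) (Fin nx) ℝ) : Matrix (Fin nu) (Fin nw) ℝ :=
  (D.H P)⁻¹ * D.Buᵀ * P * D.Bw

/-- `Kv = H⁻¹ Buᵀ`. -/
noncomputable def Kv (P : Matrix (Fin nx) (Fin nx) ℝ) : Matrix (Fin nu) (Fin nx) ℝ :=
  (D.H P)⁻¹ * D.Buᵀ

/-- The closed-loop matrix `Â = A - Bu Kx`. -/
noncomputable def Ahat (P : Matrix (Fin nx) (Fin nx) ℝ) : Matrix (Fin nx) (Fin nx) ℝ :=
  D.A - D.Bu * D.Kx P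

/-! ### Policies and their closed-loop response

The disturbance `w` is fixed and deterministic, so a deterministic policy that may use
`x 0, …, x t` and all of `w` is a function of `t` and of the state history. -/

/-- A deterministic policy for a given disturbance: `k t (x 0, …, x t)` is the input at time `t`. -/
abbrev Policy (nx nu : ℕ) : Type :=
  (t : ℕ) → (Fin (t + 1) → (Fin nx → ℝ)) → (Fin nu → ℝ)

/-- The closed-loop state history `(x 0, …, x t)` under the policy `K`. -/
def history (w : ℕ → Fin nw → ℝ) (x₀ : Fin nx → ℝ) (K : Policy nx nu) :
    (t : ℕ) → Fin (t + 1) → (Fin nx → ℝ)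
  | 0 => fun _ => x₀
  | t + 1 =>
      Fin.snoc (α := fun _ => Fin nx → ℝ) (history w x₀ K t)
        (D.A *ᵥ history w x₀ K t (Fin.last t) + D.Bu *ᵥ K t (history w x₀ K t) + D.Bw *ᵥ w t)

/-- The closed-loop state `x t`. -/
def state (w : ℕ → Fin nw → ℝ) (x₀ : Fin nx → ℝ) (K : Policy nx nu) (t : ℕ) : Fin nx → ℝ :=
  D.history w x₀ K t (Fin.last t)

/-- The closed-loop input `u t`. -/
def input (w : ℕ → Fin nw → ℝ) (x₀ : Fin nx → ℝ) (K : Policy nx nu) (t : ℕ) : Fin nu → ℝ :=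
  K t (D.history w x₀ K t)

/-- The cost `∑ₜ xₜᵀ Q xₜ + uₜᵀ R uₜ`, with values in `[0, ∞]`; the summands are nonnegative
when `Q ⪰ 0` and `R ≻ 0`. -/
noncomputable def cost (w : ℕ → Fin nw → ℝ) (x₀ : Fin nx → ℝ) (K : Policy nx nu) : ENNReal :=
  ∑' t : ℕ, ENNReal.ofReal
    (D.state w x₀ K t ⬝ᵥ (D.Q *ᵥ D.state w x₀ K t)
      + D.input w x₀ K t ⬝ᵥ (D.R *ᵥ D.input w x₀ K t))

/-- `K` stabilizes the plant driven by `w`: the state stays bounded for every initial condition. -/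
def IsStabilizing (w : ℕ → Fin nw → ℝ) (K : Policy nx nu) : Prop :=
  ∀ x₀ : Fin nx → ℝ, ∃ M : ℝ, ∀ t : ℕ, ‖WithLp.toLp 2 (D.state w x₀ K t)‖ ≤ M

/-- The policy `u t = -Kx (x t) - Kw (w t) - Kv (v (t+1))` for a preview signal `v`. -/
noncomputable def feedback (P : Matrix (Fin nx) (Fin nx) ℝ) (w : ℕ → Fin nw → ℝ)
    (v : ℕ → Fin nx → ℝ) : Policy nx nu :=
  fun t h => -(D.Kx P *ᵥ h (Fin.last t)) - D.Kw P *ᵥ w t - D.Kv P *ᵥ v (t + 1)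

/-- The `p`-step preview signal: its value at `s = t + 1` is
`∑_{j = t+1}^{t+p} (Âᵀ)^(j-t) P Bw (w j)`. -/
noncomputable def previewSignal (P : Matrix (Fin nx) (Fin nx) ℝ) (w : ℕ → Fin nw → ℝ) (p : ℕ)
    (s : ℕ) : Fin nx → ℝ :=
  ∑ j ∈ Finset.Ico s (s + p), ((D.Ahat P)ᵀ ^ (j + 1 - s) * P * D.Bw) *ᵥ w j

/-- `v` solves the anticausal recursion `v t = Âᵀ (v (t+1) + P Bw (w t))` with `v ∞ = 0`. -/
structure IsNoncausalSignal (P : Matrix (Fin nx) (Fin nx) ℝ) (w : ℕ → Fin nw → ℝ)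
    (v : ℕ → Fin nx → ℝ) : Prop where
  recursion : ∀ t : ℕ, v t = (D.Ahat P)ᵀ *ᵥ (v (t + 1) + (P * D.Bw) *ᵥ w t)
  terminal : Tendsto v atTop (𝓝 0)

end LQRData

/-! The function `x ⬝ᵥ P x + 2 v t ⬝ᵥ x` is, up to a term independent of state and input, the
optimal cost-to-go when `w` is known. By the Riccati equation and the recursion for `v`, completing
the square in `u` shows that the stage cost plus the change of this function equals an `H`-weighted
square of `u - greedy` plus a residual depending only on `w` and `v` (`completion_of_squares`,
summed in `sum_stageCost`). Detectability makes every finite-cost trajectory square-summable, so the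
boundary terms vanish. The extra cost of such a policy over the noncausal controller is then exactly
the sum of these squares (`hasSum_excess`), which gives both optimality and uniqueness of the input.

Stability of `Ahat` is derived: the undisturbed closed loop has cost at most `x ⬝ᵥ P x`, hence by
detectability its trajectories are square-summable and the powers of `Ahat` tend to zero, therefore
geometrically. Unrolling the recursion for `v` then gives its series. Truncation after `p` terms
leaves the remainder `(Ahatᵀ) ^ p v (s + p)`, small uniformly in `s`, and the stable closed loop
transfers this to the inputs. -/

open scoped MatrixOrder in
/-- A real positive semidefinite matrix is a Gram matrix. -/
theorem Matrix.PosSemidef.exists_eq_transpose_mul_self {n : ℕ} {M : Matrix (Fin n) (Fin n) ℝ}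
    (hM : M.PosSemidef) : ∃ S : Matrix (Fin n) (Fin n) ℝ, M = Sᵀ * S := by
  obtain ⟨S, hS⟩ := CStarAlgebra.nonneg_iff_eq_star_mul_self.mp hM.nonneg
  exact ⟨S, by rw [hS, Matrix.star_eq_conjTranspose, Matrix.conjTranspose_eq_transpose_of_trivial]⟩

/-! ### Geometric decay and stable linear recursions. -/

section

attribute [local instance] Matrix.linftyOpNormedAddCommGroup Matrix.linftyOpNormedSpace
  Matrix.linftyOpNormedRing Matrix.linftyOpNormedAlgebra

/-- The powers of `M` decay geometrically. -/
def Matrix.HasGeometricDecay {n : ℕ} (M : Matrix (Fin n) (Fin n) ℝ) (C ρ : ℝ) : Prop :=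
  0 ≤ C ∧ 0 ≤ ρ ∧ ρ < 1 ∧ ∀ (k : ℕ) (x : Fin n → ℝ), ‖M ^ k *ᵥ x‖ ≤ C * ρ ^ k * ‖x‖

/-- If the powers of `a` tend to `0`, they do so geometrically. -/
theorem exists_norm_pow_le_geometric_of_tendsto {R : Type*} [NormedRing R] {a : R}
    (h : Tendsto (fun k : ℕ => a ^ k) atTop (𝓝 0)) :
    ∃ C ρ : ℝ, 0 ≤ C ∧ 0 ≤ ρ ∧ ρ < 1 ∧ ∀ k : ℕ, ‖a ^ k‖ ≤ C * ρ ^ k := by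
  obtain ⟨B, hB⟩ := h.norm.bddAbove_range
  have hB' : ∀ k, ‖a ^ k‖ ≤ B := fun k => hB ⟨k, rfl⟩
  have hB0 : 0 ≤ B := (norm_nonneg _).trans (hB' 0)
  obtain ⟨N, hN1, hN⟩ : ∃ N : ℕ, 1 ≤ N ∧ ‖a ^ N‖ ≤ 1 / 2 := by
    have h1 : ∀ᶠ k : ℕ in atTop, ‖a ^ k‖ < 1 / 2 :=
      h.norm.eventually_lt_const (by norm_num)
    obtain ⟨N, h1, h2⟩ := ((eventually_ge_atTop 1).and h1).exists
    exact ⟨N, h1, h2.le⟩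
  -- Chosen so that `ρ ^ N = 1 / 2`: each full block of `N` factors halves the norm. The incomplete
  -- block has `ρ ^ (k % N) ≥ 1 / 2`, paid for by the 2 in `2 * B`.
  set ρ : ℝ := (1 / 2 : ℝ) ^ (1 / (N : ℝ)) with hρ
  have hNpos : (0 : ℝ) < N := by exact_mod_cast hN1
  have hρ0 : 0 < ρ := by positivity
  have hρ1 : ρ < 1 := Real.rpow_lt_one (by norm_num) (by norm_num) (by positivity)
  have hρN : ρ ^ N = 1 / 2 := by
    rw [hρ, ← Real.rpow_natCast, ← Real.rpow_mul (by norm_num)]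
    simp [hNpos.ne']
  have hq : ∀ q r : ℕ, ‖a ^ (N * q + r)‖ ≤ (1 / 2) ^ q * B := by
    intro q r
    induction q with
    | zero => simpa using hB' r
    | succ q ih =>
      have : a ^ (N * (q + 1) + r) = a ^ N * a ^ (N * q + r) := by
        rw [← pow_add]; congr 1; ring
      rw [this]
      calc ‖a ^ N * a ^ (N * q + r)‖ ≤ ‖a ^ N‖ * ‖a ^ (N * q + r)‖ := norm_mul_le _ _
        _ ≤ 1 / 2 * ((1 / 2) ^ q * B) := by gcongr
        _ = _ := by ring
  refine ⟨2 * B, ρ, by positivity, hρ0.le, hρ1, fun k => ?_⟩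
  have hr : 1 / 2 ≤ ρ ^ (k % N) := by
    rw [← hρN]
    exact pow_le_pow_of_le_one hρ0.le hρ1.le (Nat.mod_lt _ hN1).le
  calc ‖a ^ k‖ = ‖a ^ (N * (k / N) + k % N)‖ := by rw [Nat.div_add_mod]
    _ ≤ (1 / 2) ^ (k / N) * B := hq _ _
    _ ≤ (1 / 2) ^ (k / N) * B * (2 * ρ ^ (k % N)) :=
        le_mul_of_one_le_right (by positivity) (by linarith)
    _ = 2 * B * (ρ ^ (N * (k / N)) * ρ ^ (k % N)) := by rw [pow_mul, hρN]; ring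
    _ = 2 * B * ρ ^ k := by rw [← pow_add, Nat.div_add_mod]

theorem Matrix.exists_hasGeometricDecay_of_tendsto {n : ℕ} {M : Matrix (Fin n) (Fin n) ℝ}
    (h : Tendsto (fun k : ℕ => M ^ k) atTop (𝓝 0)) : ∃ C ρ : ℝ, M.HasGeometricDecay C ρ := by
  obtain ⟨C, ρ, hC, h0, h1, hk⟩ := exists_norm_pow_le_geometric_of_tendsto h
  refine ⟨C, ρ, hC, h0, h1, fun k x => (Matrix.linfty_opNorm_mulVec _ _).trans ?_⟩
  gcongr
  exact hk k

/-- Gelfand's formula: `‖M ^ k‖ ^ (1 / k)` is eventually below some `r < 1`. Complexification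
preserves entrywise absolute values, hence this operator norm. -/
theorem Matrix.IsSchur.tendsto_pow {n : ℕ} {M : Matrix (Fin n) (Fin n) ℝ} (h : M.IsSchur) :
    Tendsto (fun k : ℕ => M ^ k) atTop (𝓝 0) := by
  obtain ⟨r, hr, hr1⟩ := ENNReal.lt_iff_exists_nnreal_btwn.mp h
  have hr1' : r < 1 := by exact_mod_cast hr1
  have hlim := (spectrum.pow_nnnorm_pow_one_div_tendsto_nhds_spectralRadius
    (M.map (algebraMap ℝ ℂ))).eventually_lt_const hr
  have hmap : ∀ k : ℕ, ‖(M.map (algebraMap ℝ ℂ)) ^ k‖ = ‖M ^ k‖ := by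
    intro k
    rw [← Matrix.map_pow]
    simp [Matrix.linfty_opNorm_def]
  refine tendsto_zero_iff_norm_tendsto_zero.mpr ?_
  refine squeeze_zero' (Eventually.of_forall fun _ => norm_nonneg _) ?_
    (tendsto_pow_atTop_nhds_zero_of_lt_one r.2 (by exact_mod_cast hr1'))
  filter_upwards [hlim, eventually_ge_atTop 1] with k hk hk1
  have hkpos : (0 : ℝ) < k := by exact_mod_cast hk1
  have h2 := ENNReal.rpow_le_rpow hk.le hkpos.le
  rw [← ENNReal.rpow_mul, one_div_mul_cancel hkpos.ne', ENNReal.rpow_one,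
    ENNReal.rpow_natCast] at h2
  rw [← hmap]
  exact_mod_cast h2

/-- A real matrix whose powers annihilate every vector in the limit has powers tending to `0`. -/
theorem Matrix.tendsto_pow_of_tendsto_mulVec {n : ℕ} {M : Matrix (Fin n) (Fin n) ℝ}
    (h : ∀ x : Fin n → ℝ, Tendsto (fun k : ℕ => M ^ k *ᵥ x) atTop (𝓝 0)) :
    Tendsto (fun k : ℕ => M ^ k) atTop (𝓝 0) := by
  refine tendsto_pi_nhds.mpr fun i => tendsto_pi_nhds.mpr fun j => ?_
  have := tendsto_pi_nhds.mp (h (Pi.single j 1)) i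
  simpa using this

namespace Matrix.HasGeometricDecay

variable {n : ℕ} {M : Matrix (Fin n) (Fin n) ℝ} {C ρ : ℝ}

/-- The trajectory of a driven linear recursion is dominated by a scalar recursion. -/
theorem norm_le_of_recursion (hM : M.HasGeometricDecay C ρ) {T : ℕ} {x f : ℕ → Fin n → ℝ}
    {c : ℕ → ℝ} (hx : ∀ t < T, x (t + 1) = M *ᵥ x t + f t) (hc0 : C * ‖x 0‖ ≤ c 0)
    (hc : ∀ t < T, ρ * c t + C * ‖f t‖ ≤ c (t + 1)) {t : ℕ} (ht : t ≤ T) : ∀ k : ℕ,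
    ‖M ^ k *ᵥ x t‖ ≤ ρ ^ k * c t := by
  obtain ⟨hC, h0, h1, hk⟩ := hM
  -- Controlling all free evolutions `M ^ k *ᵥ x t` at once charges the factor `C` once per input;
  -- induction at `k = 0` alone would pay it again at every step.
  induction t with
  | zero =>
    intro k
    calc _ ≤ C * ρ ^ k * ‖x 0‖ := hk k _
      _ = ρ ^ k * (C * ‖x 0‖) := by ring
      _ ≤ _ := by gcongr
  | succ t ih =>
    intro k
    have h2 : M ^ k *ᵥ x (t + 1) = M ^ (k + 1) *ᵥ x t + M ^ k *ᵥ f t := by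
      rw [hx t ht, Matrix.mulVec_add, Matrix.mulVec_mulVec, pow_succ]
    rw [h2]
    calc _ ≤ ‖M ^ (k + 1) *ᵥ x t‖ + ‖M ^ k *ᵥ f t‖ := norm_add_le _ _
      _ ≤ ρ ^ (k + 1) * c t + C * ρ ^ k * ‖f t‖ := add_le_add (ih (by omega) _) (hk _ _)
      _ = ρ ^ k * (ρ * c t + C * ‖f t‖) := by ring
      _ ≤ _ := by gcongr; exact hc t ht

/-- Bounded input, bounded state. -/
theorem norm_le_of_norm_le (hM : M.HasGeometricDecay C ρ) {x f : ℕ → Fin n → ℝ} {b : ℝ}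
    (hx : ∀ t, x (t + 1) = M *ᵥ x t + f t) (hx0 : x 0 = 0) (hf : ∀ t, ‖f t‖ ≤ b) (t : ℕ) :
    ‖x t‖ ≤ C / (1 - ρ) * b := by
  have hb : 0 ≤ b := (norm_nonneg _).trans (hf 0)
  have h1 : 0 < 1 - ρ := by linarith [hM.2.2.1]
  have hC := hM.1
  have := hM.norm_le_of_recursion (T := t) (x := x) (f := f) (c := fun _ => C / (1 - ρ) * b)
    (fun t _ => hx t) (by rw [hx0]; simp; positivity) (fun t _ => ?_) le_rfl 0
  · simpa using this
  · have h3 : C * ‖f t‖ ≤ C * b := by gcongr; exact hf t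
    have h4 : ρ * (C / (1 - ρ) * b) + C * b = C / (1 - ρ) * b := by
      field_simp; ring
    linarith

/-- Square-summable input, square-summable state, with a uniform constant. -/
theorem exists_sum_sq_le (hM : M.HasGeometricDecay C ρ) :
    ∃ L : ℝ, 0 ≤ L ∧ ∀ (T : ℕ) (x f : ℕ → Fin n → ℝ), (∀ t < T, x (t + 1) = M *ᵥ x t + f t) →
      ∑ t ∈ Finset.range (T + 1), ‖x t‖ ^ 2
        ≤ L * (‖x 0‖ ^ 2 + ∑ t ∈ Finset.range T, ‖f t‖ ^ 2) := by
  have hM' := hM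
  obtain ⟨hC, h0, h1, hk⟩ := hM'
  have hd : 0 < 1 - ρ := by linarith
  have hd1 : 1 - ρ ≤ 1 := by linarith
  refine ⟨C ^ 2 / (1 - ρ) ^ 2, by positivity, fun T x f hx => ?_⟩
  let c : ℕ → ℝ := fun t => Nat.rec (C * ‖x 0‖) (fun t y => ρ * y + C * ‖f t‖) t
  have hc : ∀ t, c (t + 1) = ρ * c t + C * ‖f t‖ := fun t => rfl
  have hcx : ∀ t ≤ T, ‖x t‖ ≤ c t := fun t ht => by
    simpa using hM.norm_le_of_recursion hx (c := c) le_rfl (fun t _ => (hc t).ge) ht 0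
  -- Convexity of the square, with weights `ρ` and `1 - ρ` on `c t` and `C * ‖f t‖ / (1 - ρ)`.
  have hstep : ∀ t, c (t + 1) ^ 2 ≤ ρ * c t ^ 2 + C ^ 2 / (1 - ρ) * ‖f t‖ ^ 2 := by
    intro t
    rw [hc]
    have : ρ * c t ^ 2 + C ^ 2 / (1 - ρ) * ‖f t‖ ^ 2 - (ρ * c t + C * ‖f t‖) ^ 2
        = ρ / (1 - ρ) * ((1 - ρ) * c t - C * ‖f t‖) ^ 2 := by
      field_simp; ring
    have h3 : 0 ≤ ρ / (1 - ρ) * ((1 - ρ) * c t - C * ‖f t‖) ^ 2 := by positivity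
    linarith
  have hsum : ∀ S, (1 - ρ) * ∑ t ∈ Finset.range S, c t ^ 2 + c S ^ 2
      ≤ c 0 ^ 2 + C ^ 2 / (1 - ρ) * ∑ t ∈ Finset.range S, ‖f t‖ ^ 2 := by
    intro S
    induction S with
    | zero => simp
    | succ S ih =>
      rw [Finset.sum_range_succ, Finset.sum_range_succ]
      have := hstep S
      nlinarith
  have hc0 : c 0 = C * ‖x 0‖ := rfl
  have hF : 0 ≤ ∑ t ∈ Finset.range T, ‖f t‖ ^ 2 := Finset.sum_nonneg fun _ _ => by positivity
  have h5 : (1 - ρ) * ∑ t ∈ Finset.range (T + 1), c t ^ 2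
      ≤ C ^ 2 / (1 - ρ) * (‖x 0‖ ^ 2 + ∑ t ∈ Finset.range T, ‖f t‖ ^ 2) := by
    have := hsum T
    rw [Finset.sum_range_succ]
    have h6 : C ^ 2 * ‖x 0‖ ^ 2 ≤ C ^ 2 / (1 - ρ) * ‖x 0‖ ^ 2 := by
      gcongr
      exact le_div_self (by positivity) hd hd1
    rw [hc0] at this
    have h7 : (1 - ρ) * c T ^ 2 ≤ c T ^ 2 := mul_le_of_le_one_left (by positivity) hd1
    nlinarith
  calc ∑ t ∈ Finset.range (T + 1), ‖x t‖ ^ 2 ≤ ∑ t ∈ Finset.range (T + 1), c t ^ 2 := by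
        refine Finset.sum_le_sum fun t ht => ?_
        have := hcx t (by simpa [Nat.lt_succ_iff] using ht)
        gcongr
    _ ≤ (C ^ 2 / (1 - ρ) * (‖x 0‖ ^ 2 + ∑ t ∈ Finset.range T, ‖f t‖ ^ 2)) / (1 - ρ) := by
        rw [le_div_iff₀ hd]; linarith
    _ = _ := by field_simp

end Matrix.HasGeometricDecay

/-! ### Square-summable sequences. -/

/-- Square summability of a sequence of real vectors. -/
def SqSummable {n : ℕ} (x : ℕ → Fin n → ℝ) : Prop := Summable fun t => ‖x t‖ ^ 2

namespace SqSummable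

variable {n m : ℕ} {x y : ℕ → Fin n → ℝ}

theorem of_norm_le (hx : SqSummable x) {z : ℕ → Fin m → ℝ} {c : ℝ} (h : ∀ t, ‖z t‖ ≤ c * ‖x t‖) :
    SqSummable z := by
  refine Summable.of_nonneg_of_le (fun _ => by positivity) (fun t => ?_)
    (Summable.mul_left (c ^ 2) hx)
  rw [← mul_pow]
  exact pow_le_pow_left₀ (norm_nonneg _) (h t) 2

theorem mulVec (hx : SqSummable x) (M : Matrix (Fin m) (Fin n) ℝ) :
    SqSummable fun t => M *ᵥ x t :=
  hx.of_norm_le fun t => Matrix.linfty_opNorm_mulVec M (x t)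

theorem neg (hx : SqSummable x) : SqSummable fun t => -x t :=
  hx.of_norm_le (c := 1) fun t => by simp

theorem add (hx : SqSummable x) (hy : SqSummable y) : SqSummable fun t => x t + y t := by
  refine Summable.of_nonneg_of_le (fun _ => by positivity) (fun t => ?_)
    ((Summable.add hx hy).mul_left 2)
  have h := norm_add_le (x t) (y t)
  have : ‖x t + y t‖ ^ 2 ≤ (‖x t‖ + ‖y t‖) ^ 2 := by gcongr
  nlinarith [sq_nonneg (‖x t‖ - ‖y t‖)]

theorem sub (hx : SqSummable x) (hy : SqSummable y) : SqSummable fun t => x t - y t := by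
  simpa only [sub_eq_add_neg] using hx.add hy.neg

theorem comp_succ (hx : SqSummable x) : SqSummable fun t => x (t + 1) :=
  (summable_nat_add_iff (f := fun t => ‖x t‖ ^ 2) 1).mpr hx

theorem tendsto (hx : SqSummable x) : Tendsto x atTop (𝓝 0) := by
  rw [tendsto_zero_iff_norm_tendsto_zero]
  have h := (Summable.tendsto_atTop_zero hx).sqrt
  simpa using h

theorem summable_dotProduct (hx : SqSummable x) (hy : SqSummable y) :
    Summable fun t => x t ⬝ᵥ y t := by
  refine Summable.of_norm_bounded (g := fun t => (n : ℝ) * (‖x t‖ ^ 2 + ‖y t‖ ^ 2))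
    ((Summable.add hx hy).mul_left _) fun t => ?_
  calc ‖x t ⬝ᵥ y t‖ ≤ ∑ i : Fin n, ‖x t i * y t i‖ := norm_sum_le _ _
    _ ≤ ∑ _i : Fin n, (‖x t‖ ^ 2 + ‖y t‖ ^ 2) := by
        refine Finset.sum_le_sum fun i _ => ?_
        rw [norm_mul]
        have h1 := norm_le_pi_norm (x t) i
        have h2 := norm_le_pi_norm (y t) i
        nlinarith [mul_le_mul h1 h2 (norm_nonneg _) (norm_nonneg _), sq_nonneg (‖x t‖ - ‖y t‖),
          sq_nonneg (‖x t‖ + ‖y t‖)]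
    _ = _ := by simp [mul_add]

/-- A stable recursion driven by a square-summable input has a square-summable state. -/
theorem of_recursion {M : Matrix (Fin n) (Fin n) ℝ} {C ρ : ℝ} (hM : M.HasGeometricDecay C ρ)
    {f : ℕ → Fin n → ℝ} (hf : SqSummable f) (hx : ∀ t, x (t + 1) = M *ᵥ x t + f t) :
    SqSummable x := by
  obtain ⟨L, hL, h⟩ := hM.exists_sum_sq_le
  refine summable_of_sum_range_le (c := L * (‖x 0‖ ^ 2 + ∑' t, ‖f t‖ ^ 2))
    (fun _ => by positivity) fun T => ?_
  calc _ ≤ ∑ t ∈ Finset.range (T + 1), ‖x t‖ ^ 2 :=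
        Finset.sum_le_sum_of_subset_of_nonneg (by simp) fun _ _ _ => by positivity
    _ ≤ _ := h T x f fun t _ => hx t
    _ ≤ _ := by
        gcongr
        exact Summable.sum_le_tsum _ (fun _ _ => by positivity) hf

/-- A bounded solution of a stable backward recursion driven by a square-summable input is
square-summable. -/
theorem of_backward_recursion {M : Matrix (Fin n) (Fin n) ℝ} {C ρ : ℝ}
    (hM : M.HasGeometricDecay C ρ) {f : ℕ → Fin n → ℝ} (hf : SqSummable f)
    (hx : ∀ t, x t = M *ᵥ x (t + 1) + f t) {b : ℝ} (hb : ∀ t, ‖x t‖ ≤ b) : SqSummable x := by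
  obtain ⟨L, hL, h⟩ := hM.exists_sum_sq_le
  have hf0 : ∀ T, ∑ t ∈ Finset.range T, ‖f t‖ ^ 2 ≤ ∑' t, ‖f t‖ ^ 2 := fun T =>
    Summable.sum_le_tsum _ (fun _ _ => by positivity) hf
  refine summable_of_sum_range_le (c := L * (b ^ 2 + ∑' t, ‖f t‖ ^ 2))
    (fun _ => by positivity) fun T => ?_
  -- Time reversal on `[0, T]` gives a forward recursion started at `x T`; the bound `b` on that
  -- state makes the estimate independent of `T`.
  have h1 := h T (fun s => x (T - s)) (fun s => f (T - 1 - s)) fun s hs => by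
    have h2 := hx (T - 1 - s)
    rwa [show T - 1 - s + 1 = T - s by omega, show x (T - 1 - s) = x (T - (s + 1)) by
      congr 1; omega] at h2
  rw [Finset.sum_range_reflect (fun t => ‖f t‖ ^ 2) T] at h1
  have h3 := Finset.sum_range_reflect (fun t => ‖x t‖ ^ 2) (T + 1)
  simp only [Nat.add_sub_cancel] at h3
  calc _ ≤ ∑ t ∈ Finset.range (T + 1), ‖x t‖ ^ 2 :=
        Finset.sum_le_sum_of_subset_of_nonneg (by simp) fun _ _ _ => by positivity
    _ ≤ L * (‖x (T - 0)‖ ^ 2 + ∑ t ∈ Finset.range T, ‖f t‖ ^ 2) := h3 ▸ h1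
    _ ≤ _ := by
        gcongr
        · exact hb _
        · exact hf0 T

end SqSummable

theorem norm_sq_le_dotProduct_self {n : ℕ} (x : Fin n → ℝ) : ‖x‖ ^ 2 ≤ x ⬝ᵥ x := by
  have h0 : 0 ≤ x ⬝ᵥ x := Finset.sum_nonneg fun i _ => mul_self_nonneg (x i)
  have : ‖x‖ ≤ √(x ⬝ᵥ x) := (pi_norm_le_iff_of_nonneg (Real.sqrt_nonneg _)).mpr fun i => by
    rw [Real.norm_eq_abs]
    refine Real.abs_le_sqrt ?_
    rw [sq]
    exact Finset.single_le_sum (f := fun i => x i * x i) (fun i _ => mul_self_nonneg (x i))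
      (Finset.mem_univ i)
  calc ‖x‖ ^ 2 ≤ √(x ⬝ᵥ x) ^ 2 := by gcongr
    _ = _ := Real.sq_sqrt h0

/-- With `Q = Sᵀ * S` the form is the squared length of `S *ᵥ x`, and `Q *ᵥ x = Sᵀ *ᵥ (S *ᵥ x)`.
This turns finite cost into square-summable signals. -/
theorem Matrix.PosSemidef.sqSummable_mulVec {n : ℕ} {Q : Matrix (Fin n) (Fin n) ℝ}
    (hQ : Q.PosSemidef) {x : ℕ → Fin n → ℝ} (h : Summable fun t => x t ⬝ᵥ (Q *ᵥ x t)) :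
    SqSummable fun t => Q *ᵥ x t := by
  obtain ⟨S, rfl⟩ := hQ.exists_eq_transpose_mul_self
  have hS : SqSummable fun t => S *ᵥ x t := by
    refine Summable.of_nonneg_of_le (fun _ => by positivity) (fun t => ?_) h
    rw [← Matrix.mulVec_mulVec, Matrix.dotProduct_transpose_mulVec]
    exact norm_sq_le_dotProduct_self _
  simpa only [Matrix.mulVec_mulVec] using hS.mulVec Sᵀ

theorem Matrix.IsSymm.dotProduct_mulVec_comm {n : ℕ} {M : Matrix (Fin n) (Fin n) ℝ}
    (hM : M.IsSymm) (x y : Fin n → ℝ) : x ⬝ᵥ (M *ᵥ y) = y ⬝ᵥ (M *ᵥ x) := by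
  conv_lhs => rw [← hM.eq]
  exact Matrix.dotProduct_transpose_mulVec M x y

theorem Matrix.PosSemidef.isSymm {n : ℕ} {M : Matrix (Fin n) (Fin n) ℝ}
    (hM : M.PosSemidef) : M.IsSymm := by
  have := hM.isHermitian.eq
  rwa [Matrix.conjTranspose_eq_transpose_of_trivial] at this

/-! ### The one-step problem and stability of `Ahat`. -/

namespace LQRData

variable {nx nu nw : ℕ} {D : LQRData nx nu nw} {P : Matrix (Fin nx) (Fin nx) ℝ}

theorem posDef_H (hD : D.Standing) (hP : P.PosSemidef) : (D.H P).PosDef := by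
  refine hD.posDef_R.add_posSemidef ?_
  have := hP.conjTranspose_mul_mul_same D.Bu
  rwa [Matrix.conjTranspose_eq_transpose_of_trivial] at this

/-- The minimizer of the one-step problem at state `x`, disturbance input `d` and costate `v`. -/
noncomputable def greedy (D : LQRData nx nu nw) (P : Matrix (Fin nx) (Fin nx) ℝ)
    (x d v : Fin nx → ℝ) : Fin nu → ℝ :=
  -((D.H P)⁻¹ *ᵥ (D.Buᵀ *ᵥ (P *ᵥ (D.A *ᵥ x + d) + v)))

/-- Completion of squares in the one-step problem. -/
theorem completion_of_squares (hD : D.Standing) (hP : D.IsDARESolution P)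
    (x d v : Fin nx → ℝ) (u : Fin nu → ℝ) :
    x ⬝ᵥ (D.Q *ᵥ x) + u ⬝ᵥ (D.R *ᵥ u)
        + (D.A *ᵥ x + D.Bu *ᵥ u + d) ⬝ᵥ (P *ᵥ (D.A *ᵥ x + D.Bu *ᵥ u + d))
        + 2 * (v ⬝ᵥ (D.A *ᵥ x + D.Bu *ᵥ u + d))
      = x ⬝ᵥ (P *ᵥ x) + 2 * (((D.Ahat P)ᵀ *ᵥ (v + P *ᵥ d)) ⬝ᵥ x)
        + (u - D.greedy P x d v) ⬝ᵥ (D.H P *ᵥ (u - D.greedy P x d v))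
        + (d ⬝ᵥ (P *ᵥ d) + 2 * (v ⬝ᵥ d)
          - (D.Buᵀ *ᵥ (v + P *ᵥ d)) ⬝ᵥ ((D.H P)⁻¹ *ᵥ (D.Buᵀ *ᵥ (v + P *ᵥ d)))) := by
  have hH := posDef_H hD hP.posSemidef
  have hHu : IsUnit (D.H P).det := (Matrix.isUnit_iff_isUnit_det _).mp hH.isUnit
  have hHs := hH.posSemidef.isSymm
  have hHis : ((D.H P)⁻¹).IsSymm := by
    rw [Matrix.IsSymm, Matrix.transpose_nonsing_inv, hHs.eq]
  have hPs := hP.posSemidef.isSymm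
  -- In these variables the claim is a scalar identity. The Riccati equation enters through `hdare`,
  -- the form of `Ahat` through `hlin`, and the definition of `H` through `hsq`; the terms in `H⁻¹`
  -- cancel.
  set a := D.A *ᵥ x with ha
  set b := D.Bu *ᵥ u with hb
  set q := v + P *ᵥ d with hq
  set g₁ := D.Buᵀ *ᵥ (P *ᵥ a) with hg₁
  set g₂ := D.Buᵀ *ᵥ q with hg₂
  have hgreedy : D.greedy P x d v = -((D.H P)⁻¹ *ᵥ (g₁ + g₂)) := by
    rw [greedy, hg₁, hg₂, ← Matrix.mulVec_add, hq, Matrix.mulVec_add P]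
    congr 3
    abel
  have hdare : x ⬝ᵥ (P *ᵥ x) = a ⬝ᵥ (P *ᵥ a) + x ⬝ᵥ (D.Q *ᵥ x) - g₁ ⬝ᵥ ((D.H P)⁻¹ *ᵥ g₁) := by
    have h := congrArg (fun M => x ⬝ᵥ (M *ᵥ x)) hP.dare
    simp only [Matrix.zero_mulVec, dotProduct_zero, Matrix.add_mulVec, Matrix.sub_mulVec,
      dotProduct_add, dotProduct_sub, ← Matrix.mulVec_mulVec] at h
    have e₁ : ∀ z, z ⬝ᵥ g₁ = (P *ᵥ (D.Bu *ᵥ z)) ⬝ᵥ a := fun z => by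
      rw [hg₁, Matrix.dotProduct_transpose_mulVec, dotProduct_comm,
        hPs.dotProduct_mulVec_comm, dotProduct_comm]
    rw [Matrix.dotProduct_transpose_mulVec, Matrix.dotProduct_transpose_mulVec,
      ← ha, ← hg₁, ← e₁, dotProduct_comm _ a, dotProduct_comm _ g₁] at h
    linarith
  have hlin : ((D.Ahat P)ᵀ *ᵥ q) ⬝ᵥ x = a ⬝ᵥ q - g₁ ⬝ᵥ ((D.H P)⁻¹ *ᵥ g₂) := by
    have e₂ : ∀ z, q ⬝ᵥ (D.Bu *ᵥ z) = z ⬝ᵥ g₂ := fun z => by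
      rw [hg₂, Matrix.dotProduct_transpose_mulVec]
    rw [dotProduct_comm, Matrix.dotProduct_transpose_mulVec, Ahat, Kx, Matrix.sub_mulVec,
      dotProduct_sub, ← ha, dotProduct_comm q a]
    simp only [← Matrix.mulVec_mulVec]
    rw [← ha, ← hg₁, e₂, dotProduct_comm _ g₂, hHis.dotProduct_mulVec_comm g₁]
  have hsq : (u - D.greedy P x d v) ⬝ᵥ (D.H P *ᵥ (u - D.greedy P x d v))
      = u ⬝ᵥ (D.R *ᵥ u) + b ⬝ᵥ (P *ᵥ b) + 2 * (b ⬝ᵥ (P *ᵥ a) + b ⬝ᵥ q)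
        + (g₁ + g₂) ⬝ᵥ ((D.H P)⁻¹ *ᵥ (g₁ + g₂)) := by
    have hHH : D.H P *ᵥ ((D.H P)⁻¹ *ᵥ (g₁ + g₂)) = g₁ + g₂ := by
      rw [Matrix.mulVec_mulVec, Matrix.mul_nonsing_inv _ hHu, Matrix.one_mulVec]
    have huH : u ⬝ᵥ (D.H P *ᵥ u) = u ⬝ᵥ (D.R *ᵥ u) + b ⬝ᵥ (P *ᵥ b) := by
      rw [H, Matrix.add_mulVec, dotProduct_add, ← Matrix.mulVec_mulVec, ← Matrix.mulVec_mulVec,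
        Matrix.dotProduct_transpose_mulVec, ← hb, dotProduct_comm _ b]
    have hug : u ⬝ᵥ (g₁ + g₂) = b ⬝ᵥ (P *ᵥ a) + b ⬝ᵥ q := by
      rw [dotProduct_add, hg₁, hg₂, Matrix.dotProduct_transpose_mulVec,
        Matrix.dotProduct_transpose_mulVec, ← hb, dotProduct_comm _ b, dotProduct_comm _ b]
    have hexp : ∀ y z g : Fin nu → ℝ, (u + y) ⬝ᵥ (z + g)
        = u ⬝ᵥ z + u ⬝ᵥ g + (y ⬝ᵥ z + y ⬝ᵥ g) := fun y z g => by
      rw [add_dotProduct, dotProduct_add, dotProduct_add]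
    rw [hgreedy, sub_neg_eq_add, Matrix.mulVec_add (D.H P), hHH, hexp, huH, hug, hHs.dotProduct_mulVec_comm _ u, hHH, hug,
      dotProduct_comm _ (g₁ + g₂)]
    ring
  have hPd : ∀ y, y ⬝ᵥ (P *ᵥ d) = y ⬝ᵥ q - v ⬝ᵥ y := fun y => by
    rw [hq, dotProduct_add, dotProduct_comm v]; ring
  rw [hsq, hlin, hdare]
  have hg : (g₁ + g₂) ⬝ᵥ ((D.H P)⁻¹ *ᵥ (g₁ + g₂)) = g₁ ⬝ᵥ ((D.H P)⁻¹ *ᵥ g₁)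
      + 2 * (g₁ ⬝ᵥ ((D.H P)⁻¹ *ᵥ g₂)) + g₂ ⬝ᵥ ((D.H P)⁻¹ *ᵥ g₂) := by
    rw [Matrix.mulVec_add, add_dotProduct, dotProduct_add, dotProduct_add,
      hHis.dotProduct_mulVec_comm g₂ g₁]
    ring
  rw [hg]
  simp only [Matrix.mulVec_add, dotProduct_add, add_dotProduct]
  rw [hPs.dotProduct_mulVec_comm a b, hPs.dotProduct_mulVec_comm d a,
    hPs.dotProduct_mulVec_comm d b]
  linear_combination 2 * hPd a + 2 * hPd b

theorem feedback_eq_greedy (x v : Fin nx → ℝ) (w : Fin nw → ℝ) :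
    -(D.Kx P *ᵥ x) - D.Kw P *ᵥ w - D.Kv P *ᵥ v = D.greedy P x (D.Bw *ᵥ w) v := by
  simp only [greedy, Kx, Kw, Kv, Matrix.mulVec_add, ← Matrix.mulVec_mulVec, neg_add]
  abel

theorem stage_cost_nonneg (hD : D.Standing) (x : Fin nx → ℝ) (u : Fin nu → ℝ) :
    0 ≤ x ⬝ᵥ (D.Q *ᵥ x) + u ⬝ᵥ (D.R *ᵥ u) :=
  add_nonneg (hD.posSemidef_Q.dotProduct_mulVec_nonneg x)
    (hD.posDef_R.posSemidef.dotProduct_mulVec_nonneg u)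

/-- Detectability: a trajectory of finite cost driven by a square-summable disturbance has
square-summable state. -/
theorem sqSummable_of_summable_cost (hD : D.Standing) {x d : ℕ → Fin nx → ℝ}
    {u : ℕ → Fin nu → ℝ} (hx : ∀ t, x (t + 1) = D.A *ᵥ x t + D.Bu *ᵥ u t + d t)
    (hd : SqSummable d)
    (hc : Summable fun t => x t ⬝ᵥ (D.Q *ᵥ x t) + u t ⬝ᵥ (D.R *ᵥ u t)) :
    SqSummable x := by
  have hQ : SqSummable fun t => D.Q *ᵥ x t := hD.posSemidef_Q.sqSummable_mulVec <|
    Summable.of_nonneg_of_le (fun t => hD.posSemidef_Q.dotProduct_mulVec_nonneg (x t))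
      (fun t => le_add_of_nonneg_right (hD.posDef_R.posSemidef.dotProduct_mulVec_nonneg (u t))) hc
  have hR : SqSummable fun t => D.R *ᵥ u t := hD.posDef_R.posSemidef.sqSummable_mulVec <|
    Summable.of_nonneg_of_le (fun t => hD.posDef_R.posSemidef.dotProduct_mulVec_nonneg (u t))
      (fun t => le_add_of_nonneg_left (hD.posSemidef_Q.dotProduct_mulVec_nonneg (x t))) hc
  have hu : SqSummable u := by
    have hdet := (Matrix.isUnit_iff_isUnit_det _).mp hD.posDef_R.isUnit
    simpa [Matrix.nonsing_inv_mul _ hdet] using hR.mulVec D.R⁻¹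
  obtain ⟨L, hL⟩ := hD.detectable
  obtain ⟨C, ρ, hM⟩ := Matrix.exists_hasGeometricDecay_of_tendsto hL.tendsto_pow
  -- Output injection: `A x = (A + L * Q) x - L (Q x)`, where `A + L * Q` is Schur and all the
  -- remaining terms are square-summable.
  refine SqSummable.of_recursion hM (((hu.mulVec D.Bu).add hd).sub (hQ.mulVec L)) fun t => ?_
  rw [hx, Matrix.add_mulVec, Matrix.mulVec_mulVec]
  abel

/-- Without disturbance and costate, completion of squares is a Lyapunov identity: the stage cost is
the decrease of `x ⬝ᵥ P x`. As `P ⪰ 0` the total cost is finite, and detectability gives decay. -/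
theorem tendsto_Ahat_pow (hD : D.Standing) (hP : D.IsDARESolution P) :
    Tendsto (fun k : ℕ => D.Ahat P ^ k) atTop (𝓝 0) := by
  refine Matrix.tendsto_pow_of_tendsto_mulVec fun y => SqSummable.tendsto ?_
  set x : ℕ → Fin nx → ℝ := fun k => D.Ahat P ^ k *ᵥ y with hx
  set u : ℕ → Fin nu → ℝ := fun k => D.greedy P (x k) 0 0 with hu
  have hug : ∀ k, u k = -(D.Kx P *ᵥ x k) := fun k => by
    simp [hu, greedy, Kx, ← Matrix.mulVec_mulVec]
  have hstep : ∀ k, x (k + 1) = D.A *ᵥ x k + D.Bu *ᵥ u k + 0 := fun k => by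
    have h : x (k + 1) = D.Ahat P *ᵥ x k := by
      simp only [hx, pow_succ', ← Matrix.mulVec_mulVec]
    rw [h, hug, add_zero, Matrix.mulVec_neg, ← sub_eq_add_neg, Ahat, Matrix.sub_mulVec,
      ← Matrix.mulVec_mulVec]
  have hlyap : ∀ k, x k ⬝ᵥ (D.Q *ᵥ x k) + u k ⬝ᵥ (D.R *ᵥ u k)
      = x k ⬝ᵥ (P *ᵥ x k) - x (k + 1) ⬝ᵥ (P *ᵥ x (k + 1)) := fun k => by
    have := completion_of_squares hD hP (x k) 0 0 (u k)
    rw [← hstep, show u k = D.greedy P (x k) 0 0 from rfl] at this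
    simp at this
    rw [hu]
    linarith
  refine sqSummable_of_summable_cost hD (d := fun _ => 0) hstep ?_
    (summable_of_sum_range_le (c := x 0 ⬝ᵥ (P *ᵥ x 0)) (fun k => stage_cost_nonneg hD _ _)
      fun T => ?_)
  · simp [SqSummable, summable_zero]
  · rw [Finset.sum_congr rfl fun k _ => hlyap k,
      Finset.sum_range_sub' (fun k => x k ⬝ᵥ (P *ᵥ x k))]
    have : 0 ≤ x T ⬝ᵥ (P *ᵥ x T) := hP.posSemidef.dotProduct_mulVec_nonneg (x T)
    linarith

theorem exists_Ahat_hasGeometricDecay (hD : D.Standing) (hP : D.IsDARESolution P) :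
    ∃ C ρ, (D.Ahat P).HasGeometricDecay C ρ :=
  Matrix.exists_hasGeometricDecay_of_tendsto (tendsto_Ahat_pow hD hP)

theorem exists_Ahat_transpose_hasGeometricDecay (hD : D.Standing) (hP : D.IsDARESolution P) :
    ∃ C ρ, (D.Ahat P)ᵀ.HasGeometricDecay C ρ := by
  refine Matrix.exists_hasGeometricDecay_of_tendsto ?_
  have h : Tendsto (fun k => (D.Ahat P ^ k)ᵀ) atTop (𝓝 (0 : Matrix (Fin nx) (Fin nx) ℝ)ᵀ) :=
    (Continuous.matrix_transpose continuous_id).continuousAt.tendsto.comp (tendsto_Ahat_pow hD hP)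
  simpa [Matrix.transpose_pow] using h

/-! ### The noncausal preview signal -/

section Signal

variable {w : ℕ → Fin nw → ℝ} {v : ℕ → Fin nx → ℝ}

/-- The exact remainder yields both the series for `v` and the preview error. -/
theorem IsNoncausalSignal.eq_sum (hv : D.IsNoncausalSignal P w v) (t p : ℕ) :
    v t = ∑ k ∈ Finset.range p, ((D.Ahat P)ᵀ ^ (k + 1) * P * D.Bw) *ᵥ w (t + k)
      + (D.Ahat P)ᵀ ^ p *ᵥ v (t + p) := by
  induction p with
  | zero => simp
  | succ p ih =>
    rw [Finset.sum_range_succ, ih, hv.recursion (t + p), Matrix.mulVec_mulVec, ← pow_succ,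
      Matrix.mulVec_add, Matrix.mulVec_mulVec, ← Matrix.mul_assoc, add_assoc,
      add_comm (_ *ᵥ v _), ← add_assoc t p 1, ← add_assoc]

theorem summable_norm_signal (hD : D.Standing) (hP : D.IsDARESolution P) {b : ℝ}
    (hw : ∀ t, ‖w t‖ ≤ b) : ∃ g : ℕ → ℝ, Summable g ∧
      ∀ t k, ‖((D.Ahat P)ᵀ ^ (k + 1) * P * D.Bw) *ᵥ w (t + k)‖ ≤ g k := by
  obtain ⟨C, ρ, hC, h0, h1, hk⟩ := exists_Ahat_transpose_hasGeometricDecay hD hP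
  refine ⟨fun k => C * ρ ^ (k + 1) * (‖P * D.Bw‖ * b), ?_, fun t k => ?_⟩
  · exact (((summable_nat_add_iff 1).mpr (summable_geometric_of_lt_one h0 h1)).mul_left C).mul_right _
  · rw [Matrix.mul_assoc, ← Matrix.mulVec_mulVec]
    refine (hk _ _).trans (mul_le_mul_of_nonneg_left ?_ (by positivity))
    refine (Matrix.linfty_opNorm_mulVec _ _).trans ?_
    gcongr
    exact hw _

theorem IsNoncausalSignal.hasSum (hD : D.Standing) (hP : D.IsDARESolution P)
    (hw : SqSummable w) (hv : D.IsNoncausalSignal P w v) (t : ℕ) :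
    HasSum (fun k => ((D.Ahat P)ᵀ ^ (k + 1) * P * D.Bw) *ᵥ w (t + k)) (v t) := by
  obtain ⟨b, hb⟩ := hw.tendsto.norm.bddAbove_range
  obtain ⟨g, hg, hgb⟩ := summable_norm_signal hD hP (w := w) fun t => hb ⟨t, rfl⟩
  rw [hasSum_iff_tendsto_nat_of_summable_norm
    (Summable.of_nonneg_of_le (fun _ => norm_nonneg _) (hgb t) hg)]
  obtain ⟨C, ρ, hC, h0, h1, hk⟩ := exists_Ahat_transpose_hasGeometricDecay hD hP
  have hz : Tendsto (fun p => (D.Ahat P)ᵀ ^ p *ᵥ v (t + p)) atTop (𝓝 0) := by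
    refine squeeze_zero_norm (fun p => hk p (v (t + p))) ?_
    have h2 : Tendsto (fun p => ‖v (t + p)‖) atTop (𝓝 0) := by
      have := (hv.terminal.norm).comp (tendsto_add_atTop_nat t)
      simpa [Function.comp_def, add_comm] using this
    simpa using ((tendsto_pow_atTop_nhds_zero_of_lt_one h0 h1).const_mul C).mul h2
  have h3 := (tendsto_const_nhds (x := v t)).sub hz
  rw [sub_zero] at h3
  exact h3.congr fun p => sub_eq_of_eq_add (hv.eq_sum t p)

theorem exists_isNoncausalSignal (hD : D.Standing) (hP : D.IsDARESolution P)
    (hw : SqSummable w) : ∃ v, D.IsNoncausalSignal P w v := by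
  obtain ⟨b, hb⟩ := hw.tendsto.norm.bddAbove_range
  obtain ⟨g, hg, hgb⟩ := summable_norm_signal hD hP (w := w) fun t => hb ⟨t, rfl⟩
  have hs : ∀ t, Summable fun k => ((D.Ahat P)ᵀ ^ (k + 1) * P * D.Bw) *ᵥ w (t + k) :=
    fun t => Summable.of_norm_bounded hg (hgb t)
  refine ⟨fun t => ∑' k, ((D.Ahat P)ᵀ ^ (k + 1) * P * D.Bw) *ᵥ w (t + k), fun t => ?_, ?_⟩
  · have hL : HasSum
        (fun k => (D.Ahat P)ᵀ *ᵥ (((D.Ahat P)ᵀ ^ (k + 1) * P * D.Bw) *ᵥ w (t + 1 + k)))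
        ((D.Ahat P)ᵀ *ᵥ ∑' k, ((D.Ahat P)ᵀ ^ (k + 1) * P * D.Bw) *ᵥ w (t + 1 + k)) :=
      (hs (t + 1)).hasSum.map (Matrix.mulVecLin (D.Ahat P)ᵀ).toAddMonoidHom
        (Continuous.matrix_mulVec continuous_const continuous_id)
    rw [(hs t).tsum_eq_zero_add, Matrix.mulVec_add, ← hL.tsum_eq, add_comm]
    congr 1
    · refine tsum_congr fun k => ?_
      rw [Matrix.mulVec_mulVec, ← Matrix.mul_assoc, ← Matrix.mul_assoc, ← pow_succ',
        show t + 1 + k = t + (k + 1) by ring]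
    · simp [Matrix.mul_assoc]
  -- Each term vanishes as `t → ∞` because `w` does, and the bound `g` does not depend on `t`.
  · have := tendsto_tsum_of_dominated_convergence (𝓕 := atTop) (f := fun t k =>
      ((D.Ahat P)ᵀ ^ (k + 1) * P * D.Bw) *ᵥ w (t + k)) (g := fun _ => 0) hg (fun k => ?_)
      (Eventually.of_forall hgb)
    · simpa using this
    · have h1 := hw.tendsto.comp (tendsto_add_atTop_nat k)
      have h2 := ((Continuous.matrix_mulVec (A := fun _ : Fin nw → ℝ =>
        (D.Ahat P)ᵀ ^ (k + 1) * P * D.Bw) continuous_const continuous_id).tendsto 0).comp h1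
      simpa [Function.comp_def] using h2

theorem IsNoncausalSignal.unique (hD : D.Standing) (hP : D.IsDARESolution P)
    (hw : SqSummable w) {v' : ℕ → Fin nx → ℝ} (hv : D.IsNoncausalSignal P w v)
    (hv' : D.IsNoncausalSignal P w v') : v = v' :=
  funext fun t => (hv.hasSum hD hP hw t).unique (hv'.hasSum hD hP hw t)

/-- Needed for finite cost of the noncausal controller and for the boundary term `v T ⬝ᵥ x T` to
vanish. -/
theorem IsNoncausalSignal.sqSummable (hD : D.Standing) (hP : D.IsDARESolution P)
    (hw : SqSummable w) (hv : D.IsNoncausalSignal P w v) : SqSummable v := by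
  obtain ⟨C, ρ, hM⟩ := exists_Ahat_transpose_hasGeometricDecay hD hP
  obtain ⟨b, hb⟩ := hv.terminal.norm.bddAbove_range
  exact SqSummable.of_backward_recursion hM ((hw.mulVec (P * D.Bw)).mulVec (D.Ahat P)ᵀ)
    (fun t => (hv.recursion t).trans (Matrix.mulVec_add _ _ _)) fun t => hb ⟨t, rfl⟩

theorem IsNoncausalSignal.sub_previewSignal (hv : D.IsNoncausalSignal P w v) (p s : ℕ) :
    v s - D.previewSignal P w p s = (D.Ahat P)ᵀ ^ p *ᵥ v (s + p) := by
  rw [previewSignal, Finset.sum_Ico_eq_sum_range, hv.eq_sum s p, sub_eq_iff_eq_add,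
    add_comm, Nat.add_sub_cancel_left]
  congr 1
  refine Finset.sum_congr rfl fun k _ => ?_
  rw [show s + k + 1 - s = k + 1 by omega]

/-- The finite previews converge to the noncausal signal uniformly in time. -/
theorem IsNoncausalSignal.eventually_norm_sub_previewSignal_le (hD : D.Standing)
    (hP : D.IsDARESolution P) (hv : D.IsNoncausalSignal P w v) {δ : ℝ} (hδ : 0 < δ) :
    ∃ N : ℕ, ∀ p, N ≤ p → ∀ s, ‖v s - D.previewSignal P w p s‖ ≤ δ := by
  obtain ⟨C, ρ, hC, h0, h1, hk⟩ := exists_Ahat_transpose_hasGeometricDecay hD hP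
  obtain ⟨b, hb⟩ := hv.terminal.norm.bddAbove_range
  have hlim : Tendsto (fun p : ℕ => C * ρ ^ p * b) atTop (𝓝 0) := by
    simpa using ((tendsto_pow_atTop_nhds_zero_of_lt_one h0 h1).const_mul C).mul_const b
  obtain ⟨N, hN⟩ := eventually_atTop.mp (hlim.eventually_lt_const hδ)
  refine ⟨N, fun p hp s => ?_⟩
  rw [hv.sub_previewSignal]
  refine (hk p _).trans (le_trans ?_ (hN p hp).le)
  gcongr
  exact hb ⟨s + p, rfl⟩

end Signal

end LQRData

namespace LQRData

variable {nx nu nw : ℕ} {D : LQRData nx nu nw} {P : Matrix (Fin nx) (Fin nx) ℝ}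
  {w : ℕ → Fin nw → ℝ} {v : ℕ → Fin nx → ℝ}

/-! ### Closed-loop responses -/

theorem state_zero (D : LQRData nx nu nw) (w : ℕ → Fin nw → ℝ) (x₀ : Fin nx → ℝ)
    (K : Policy nx nu) : D.state w x₀ K 0 = x₀ := rfl

theorem state_succ (D : LQRData nx nu nw) (w : ℕ → Fin nw → ℝ) (x₀ : Fin nx → ℝ)
    (K : Policy nx nu) (t : ℕ) :
    D.state w x₀ K (t + 1)
      = D.A *ᵥ D.state w x₀ K t + D.Bu *ᵥ D.input w x₀ K t + D.Bw *ᵥ w t := by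
  simp [state, input, history]

theorem input_feedback (D : LQRData nx nu nw) (P : Matrix (Fin nx) (Fin nx) ℝ)
    (w : ℕ → Fin nw → ℝ) (v : ℕ → Fin nx → ℝ) (x₀ : Fin nx → ℝ) (t : ℕ) :
    D.input w x₀ (D.feedback P w v) t
      = -(D.Kx P *ᵥ D.state w x₀ (D.feedback P w v) t) - D.Kw P *ᵥ w t
        - D.Kv P *ᵥ v (t + 1) := rfl

theorem state_feedback_succ (D : LQRData nx nu nw) (P : Matrix (Fin nx) (Fin nx) ℝ)
    (w : ℕ → Fin nw → ℝ) (v : ℕ → Fin nx → ℝ) (x₀ : Fin nx → ℝ) (t : ℕ) :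
    D.state w x₀ (D.feedback P w v) (t + 1)
      = D.Ahat P *ᵥ D.state w x₀ (D.feedback P w v) t
        + (D.Bw *ᵥ w t - D.Bu *ᵥ (D.Kw P *ᵥ w t) - D.Bu *ᵥ (D.Kv P *ᵥ v (t + 1))) := by
  rw [state_succ, input_feedback, Ahat, Matrix.sub_mulVec, Matrix.mulVec_sub, Matrix.mulVec_sub,
    Matrix.mulVec_neg, ← Matrix.mulVec_mulVec]
  abel

/-- The cost of a stage of the closed loop. -/
noncomputable def stageCost (D : LQRData nx nu nw) (w : ℕ → Fin nw → ℝ) (x₀ : Fin nx → ℝ)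
    (K : Policy nx nu) (t : ℕ) : ℝ :=
  D.state w x₀ K t ⬝ᵥ (D.Q *ᵥ D.state w x₀ K t) + D.input w x₀ K t ⬝ᵥ (D.R *ᵥ D.input w x₀ K t)

theorem stageCost_nonneg (hD : D.Standing) (x₀ : Fin nx → ℝ) (K : Policy nx nu) (t : ℕ) :
    0 ≤ D.stageCost w x₀ K t :=
  stage_cost_nonneg hD _ _

theorem summable_stageCost_of_cost_ne_top (hD : D.Standing) {x₀ : Fin nx → ℝ} {K : Policy nx nu}
    (h : D.cost w x₀ K ≠ ⊤) : Summable (D.stageCost w x₀ K) := by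
  have := ENNReal.summable_toReal (f := fun t => ENNReal.ofReal (D.stageCost w x₀ K t)) h
  exact this.congr fun t => ENNReal.toReal_ofReal (stageCost_nonneg hD _ _ _)

theorem cost_eq_ofReal_tsum (hD : D.Standing) {x₀ : Fin nx → ℝ} {K : Policy nx nu}
    (h : Summable (D.stageCost w x₀ K)) :
    D.cost w x₀ K = ENNReal.ofReal (∑' t, D.stageCost w x₀ K t) :=
  (ENNReal.ofReal_tsum_of_nonneg (stageCost_nonneg hD x₀ K) h).symm

theorem sqSummable_state_feedback (hD : D.Standing) (hP : D.IsDARESolution P) (hw : SqSummable w)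
    (hv : D.IsNoncausalSignal P w v) (x₀ : Fin nx → ℝ) :
    SqSummable (D.state w x₀ (D.feedback P w v)) := by
  obtain ⟨C, ρ, hM⟩ := exists_Ahat_hasGeometricDecay hD hP
  exact SqSummable.of_recursion hM (((hw.mulVec D.Bw).sub ((hw.mulVec _).mulVec D.Bu)).sub
    (((hv.sqSummable hD hP hw).comp_succ.mulVec _).mulVec D.Bu))
    (state_feedback_succ D P w v x₀)

theorem summable_stageCost_feedback (hD : D.Standing) (hP : D.IsDARESolution P)
    (hw : SqSummable w) (hv : D.IsNoncausalSignal P w v) (x₀ : Fin nx → ℝ) :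
    Summable (D.stageCost w x₀ (D.feedback P w v)) := by
  have hx := sqSummable_state_feedback hD hP hw hv x₀
  have hu : SqSummable (D.input w x₀ (D.feedback P w v)) :=
    ((hx.mulVec (D.Kx P)).neg.sub (hw.mulVec (D.Kw P))).sub
      ((hv.sqSummable hD hP hw).comp_succ.mulVec (D.Kv P))
  exact (hx.summable_dotProduct (hx.mulVec D.Q)).add (hu.summable_dotProduct (hu.mulVec D.R))

/-! ### Optimality and uniqueness of the input. -/

/-- The excess of an input over the greedy one, weighted by `H`. -/
noncomputable def excess (D : LQRData nx nu nw) (P : Matrix (Fin nx) (Fin nx) ℝ)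
    (w : ℕ → Fin nw → ℝ) (v : ℕ → Fin nx → ℝ) (x₀ : Fin nx → ℝ) (K : Policy nx nu) (t : ℕ) : ℝ :=
  (D.input w x₀ K t - D.greedy P (D.state w x₀ K t) (D.Bw *ᵥ w t) (v (t + 1))) ⬝ᵥ
    (D.H P *ᵥ (D.input w x₀ K t - D.greedy P (D.state w x₀ K t) (D.Bw *ᵥ w t) (v (t + 1))))

theorem excess_nonneg (hD : D.Standing) (hP : D.IsDARESolution P) (x₀ : Fin nx → ℝ)
    (K : Policy nx nu) (t : ℕ) : 0 ≤ D.excess P w v x₀ K t :=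
  (posDef_H hD hP.posSemidef).posSemidef.dotProduct_mulVec_nonneg _

theorem excess_feedback (D : LQRData nx nu nw) (P : Matrix (Fin nx) (Fin nx) ℝ)
    (w : ℕ → Fin nw → ℝ) (v : ℕ → Fin nx → ℝ) (x₀ : Fin nx → ℝ) (t : ℕ) :
    D.excess P w v x₀ (D.feedback P w v) t = 0 := by
  rw [excess, input_feedback, feedback_eq_greedy, sub_self, zero_dotProduct]

/-- Since `H` is positive definite, zero excess forces the greedy input at every time; by induction
the two trajectories coincide. -/
theorem input_eq_of_excess_eq_zero (hD : D.Standing) (hP : D.IsDARESolution P)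
    {x₀ : Fin nx → ℝ} {K : Policy nx nu} (h : ∀ t, D.excess P w v x₀ K t = 0) :
    D.input w x₀ K = D.input w x₀ (D.feedback P w v) := by
  have hu : ∀ t, D.input w x₀ K t
      = D.greedy P (D.state w x₀ K t) (D.Bw *ᵥ w t) (v (t + 1)) := fun t => by
    by_contra hne
    exact ((posDef_H hD hP.posSemidef).dotProduct_mulVec_pos (sub_ne_zero.mpr hne)).ne' (h t)
  have hx : ∀ t, D.state w x₀ K t = D.state w x₀ (D.feedback P w v) t := fun t => by
    induction t with
    | zero => rfl
    | succ t ih =>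
      rw [state_succ, state_succ, hu, input_feedback, feedback_eq_greedy, ih]
  funext t
  rw [hu, input_feedback, feedback_eq_greedy, hx]

/-- The part of the cost that no input can influence. -/
noncomputable def residual (D : LQRData nx nu nw) (P : Matrix (Fin nx) (Fin nx) ℝ)
    (w : ℕ → Fin nw → ℝ) (v : ℕ → Fin nx → ℝ) (t : ℕ) : ℝ :=
  (D.Bw *ᵥ w t) ⬝ᵥ (P *ᵥ (D.Bw *ᵥ w t)) + 2 * (v (t + 1) ⬝ᵥ (D.Bw *ᵥ w t))
    - (D.Buᵀ *ᵥ (v (t + 1) + P *ᵥ (D.Bw *ᵥ w t))) ⬝ᵥ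
      ((D.H P)⁻¹ *ᵥ (D.Buᵀ *ᵥ (v (t + 1) + P *ᵥ (D.Bw *ᵥ w t))))

theorem sum_stageCost (hD : D.Standing) (hP : D.IsDARESolution P)
    (hv : D.IsNoncausalSignal P w v) (x₀ : Fin nx → ℝ) (K : Policy nx nu) (T : ℕ) :
    ∑ t ∈ Finset.range T, D.stageCost w x₀ K t
        + (D.state w x₀ K T ⬝ᵥ (P *ᵥ D.state w x₀ K T) + 2 * (v T ⬝ᵥ D.state w x₀ K T))
      = x₀ ⬝ᵥ (P *ᵥ x₀) + 2 * (v 0 ⬝ᵥ x₀) + ∑ t ∈ Finset.range T, D.excess P w v x₀ K t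
        + ∑ t ∈ Finset.range T, D.residual P w v t := by
  induction T with
  | zero => simp [state_zero]
  | succ T ih =>
    have h := completion_of_squares hD hP (D.state w x₀ K T) (D.Bw *ᵥ w T) (v (T + 1))
      (D.input w x₀ K T)
    have hr := hv.recursion T
    rw [← Matrix.mulVec_mulVec] at hr
    rw [← state_succ, ← hr] at h
    simp only [Finset.sum_range_succ]
    rw [stageCost, excess, residual]
    linarith

/-- A policy of finite cost pays exactly its excess over the noncausal controller. -/
theorem hasSum_excess (hD : D.Standing) (hP : D.IsDARESolution P) (hw : SqSummable w)
    (hv : D.IsNoncausalSignal P w v) {x₀ : Fin nx → ℝ} {K : Policy nx nu}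
    (hK : Summable (D.stageCost w x₀ K)) :
    HasSum (D.excess P w v x₀ K)
      (∑' t, D.stageCost w x₀ K t - ∑' t, D.stageCost w x₀ (D.feedback P w v) t) := by
  have key : ∀ {K' : Policy nx nu}, Summable (D.stageCost w x₀ K') →
      Tendsto (fun T => ∑ t ∈ Finset.range T, D.excess P w v x₀ K' t
        + ∑ t ∈ Finset.range T, D.residual P w v t) atTop
        (𝓝 (∑' t, D.stageCost w x₀ K' t - (x₀ ⬝ᵥ (P *ᵥ x₀) + 2 * (v 0 ⬝ᵥ x₀)))) := by
    intro K' hK'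
    have hx := sqSummable_of_summable_cost hD (state_succ D w x₀ K') (hw.mulVec D.Bw) hK'
    have h1 := (hx.summable_dotProduct (hx.mulVec P)).tendsto_atTop_zero
    have h2 := ((hv.sqSummable hD hP hw).summable_dotProduct hx).tendsto_atTop_zero
    have h3 := (hK'.hasSum.tendsto_sum_nat.add (h1.add (h2.const_mul 2))).sub_const
      (x₀ ⬝ᵥ (P *ᵥ x₀) + 2 * (v 0 ⬝ᵥ x₀))
    simp only [mul_zero, add_zero] at h3
    refine h3.congr fun T => ?_
    rw [sum_stageCost hD hP hv]
    ring
  rw [hasSum_iff_tendsto_nat_of_nonneg (excess_nonneg hD hP x₀ K)]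
  -- Subtracting the instance for the noncausal controller, whose excess is zero, cancels the
  -- residual sums without a separate proof that they converge.
  have h := (key hK).sub (key (summable_stageCost_feedback hD hP hw hv x₀))
  simpa [excess_feedback] using h

theorem cost_feedback_le (hD : D.Standing) (hP : D.IsDARESolution P) (hw : SqSummable w)
    (hv : D.IsNoncausalSignal P w v) (x₀ : Fin nx → ℝ) (K : Policy nx nu) :
    D.cost w x₀ (D.feedback P w v) ≤ D.cost w x₀ K := by
  by_cases h : D.cost w x₀ K = ⊤
  · simp [h]
  have hK := summable_stageCost_of_cost_ne_top hD h
  rw [cost_eq_ofReal_tsum hD hK,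
    cost_eq_ofReal_tsum hD (summable_stageCost_feedback hD hP hw hv x₀)]
  exact ENNReal.ofReal_le_ofReal <| sub_nonneg.mp <|
    (hasSum_excess hD hP hw hv hK).nonneg (excess_nonneg hD hP x₀ K)

theorem cost_feedback_ne_top (hD : D.Standing) (hP : D.IsDARESolution P) (hw : SqSummable w)
    (hv : D.IsNoncausalSignal P w v) (x₀ : Fin nx → ℝ) :
    D.cost w x₀ (D.feedback P w v) ≠ ⊤ :=
  (summable_stageCost_feedback hD hP hw hv x₀).tsum_ofReal_ne_top

theorem input_eq_of_cost_eq (hD : D.Standing) (hP : D.IsDARESolution P) (hw : SqSummable w)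
    (hv : D.IsNoncausalSignal P w v) {x₀ : Fin nx → ℝ} {K : Policy nx nu}
    (h : D.cost w x₀ K = D.cost w x₀ (D.feedback P w v)) :
    D.input w x₀ K = D.input w x₀ (D.feedback P w v) := by
  have hF := summable_stageCost_feedback hD hP hw hv x₀
  have hK := summable_stageCost_of_cost_ne_top hD (h ▸ cost_feedback_ne_top hD hP hw hv x₀)
  rw [cost_eq_ofReal_tsum hD hK, cost_eq_ofReal_tsum hD hF,
    ENNReal.ofReal_eq_ofReal_iff (tsum_nonneg (stageCost_nonneg hD _ _))
      (tsum_nonneg (stageCost_nonneg hD _ _))] at h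
  have hs := hasSum_excess hD hP hw hv hK
  rw [h, sub_self, hasSum_zero_iff_of_nonneg (excess_nonneg hD hP x₀ K)] at hs
  exact input_eq_of_excess_eq_zero hD hP fun t => congrFun hs t

theorem isStabilizing_feedback (hD : D.Standing) (hP : D.IsDARESolution P) (hw : SqSummable w)
    (hv : D.IsNoncausalSignal P w v) : D.IsStabilizing w (D.feedback P w v) := by
  intro x₀
  have h := (((PiLp.continuous_toLp 2 _).tendsto (0 : Fin nx → ℝ)).comp
    (sqSummable_state_feedback hD hP hw hv x₀).tendsto).norm
  obtain ⟨M, hM⟩ := h.bddAbove_range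
  exact ⟨M, fun t => hM ⟨t, rfl⟩⟩

/-! ### Convergence of the finite-preview controllers. -/

/-- Inputs generated by feedback depend on the preview signal in a Lipschitz way. -/
theorem exists_norm_input_feedback_sub_le (hD : D.Standing) (hP : D.IsDARESolution P) :
    ∃ L : ℝ, 0 ≤ L ∧ ∀ (w : ℕ → Fin nw → ℝ) (v v' : ℕ → Fin nx → ℝ) (x₀ : Fin nx → ℝ) (δ : ℝ),
      (∀ t, ‖v t - v' t‖ ≤ δ) → ∀ t,
        ‖D.input w x₀ (D.feedback P w v) t - D.input w x₀ (D.feedback P w v') t‖ ≤ L * δ := by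
  obtain ⟨C, ρ, hM⟩ := exists_Ahat_hasGeometricDecay hD hP
  have hC := hM.1
  have hρ : 0 < 1 - ρ := by linarith [hM.2.2.1]
  refine ⟨‖D.Kx P‖ * (C / (1 - ρ) * ‖D.Bu * D.Kv P‖) + ‖D.Kv P‖, by positivity,
    fun w v v' x₀ δ hδ t => ?_⟩
  set e : ℕ → Fin nx → ℝ := fun t =>
    D.state w x₀ (D.feedback P w v) t - D.state w x₀ (D.feedback P w v') t with he
  -- The common disturbance drops out: the state difference starts at zero and is driven only by the
  -- preview error.
  have hstep : ∀ t, e (t + 1)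
      = D.Ahat P *ᵥ e t + -((D.Bu * D.Kv P) *ᵥ (v (t + 1) - v' (t + 1))) := fun t => by
    simp only [he]
    rw [state_feedback_succ, state_feedback_succ, Matrix.mulVec_sub, Matrix.mulVec_sub,
      ← Matrix.mulVec_mulVec, ← Matrix.mulVec_mulVec]
    abel
  have hbound : ‖e t‖ ≤ C / (1 - ρ) * (‖D.Bu * D.Kv P‖ * δ) := by
    refine hM.norm_le_of_norm_le hstep (by simp [he, state_zero]) (fun t => ?_) t
    rw [norm_neg]
    refine (Matrix.linfty_opNorm_mulVec _ _).trans ?_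
    gcongr
    exact hδ _
  have hu : D.input w x₀ (D.feedback P w v) t - D.input w x₀ (D.feedback P w v') t
      = -(D.Kx P *ᵥ e t) - D.Kv P *ᵥ (v (t + 1) - v' (t + 1)) := by
    rw [input_feedback, input_feedback, he, Matrix.mulVec_sub, Matrix.mulVec_sub]
    abel
  rw [hu]
  calc _ ≤ ‖-(D.Kx P *ᵥ e t)‖ + ‖D.Kv P *ᵥ (v (t + 1) - v' (t + 1))‖ := norm_sub_le _ _
    _ ≤ ‖D.Kx P‖ * ‖e t‖ + ‖D.Kv P‖ * ‖v (t + 1) - v' (t + 1)‖ := by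
        rw [norm_neg]
        exact add_le_add (Matrix.linfty_opNorm_mulVec _ _) (Matrix.linfty_opNorm_mulVec _ _)
    _ ≤ ‖D.Kx P‖ * (C / (1 - ρ) * (‖D.Bu * D.Kv P‖ * δ)) + ‖D.Kv P‖ * δ := by
        gcongr
        exact hδ _
    _ = _ := by ring

theorem exists_forall_norm_input_sub_lt (hD : D.Standing) (hP : D.IsDARESolution P)
    (hv : D.IsNoncausalSignal P w v) (x₀ : Fin nx → ℝ) {ε : ℝ} (hε : 0 < ε) :
    ∃ N : ℕ, ∀ p : ℕ, N ≤ p → ∀ t : ℕ,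
      ‖WithLp.toLp 2 (D.input w x₀ (D.feedback P w v) t
        - D.input w x₀ (D.feedback P w (D.previewSignal P w p)) t)‖ < ε := by
  obtain ⟨L, hL, hLip⟩ := exists_norm_input_feedback_sub_le (nw := nw) hD hP
  -- The estimates are in the sup norm; continuity at zero passes to the Euclidean norm. Dividing
  -- `η` by `L + 1` below allows `L = 0` and keeps the inequality strict.
  have hcont := (((PiLp.continuous_toLp 2 _).tendsto (0 : Fin nu → ℝ)).norm)
  rw [WithLp.toLp_zero, norm_zero] at hcont
  obtain ⟨η, hη, hηε⟩ := Metric.eventually_nhds_iff.mp (hcont.eventually_lt_const hε)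
  obtain ⟨N, hN⟩ := hv.eventually_norm_sub_previewSignal_le hD hP
    (δ := η / (L + 1)) (by positivity)
  refine ⟨N, fun p hp t => hηε ?_⟩
  rw [dist_zero_right]
  calc _ ≤ L * (η / (L + 1)) := hLip w v _ x₀ _ (hN p hp) t
    _ < η := by
        rw [mul_div_assoc', div_lt_iff₀ (by positivity)]
        nlinarith

theorem IsNoncausalSignal.hasSum_Ici (hD : D.Standing) (hP : D.IsDARESolution P)
    (hw : SqSummable w) (hv : D.IsNoncausalSignal P w v) (t : ℕ) :
    HasSum (fun j : Set.Ici (t + 1) => ((D.Ahat P)ᵀ ^ ((j : ℕ) - t) * P * D.Bw) *ᵥ w j)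
      (v (t + 1)) := by
  let e : ℕ ≃ Set.Ici (t + 1) :=
    { toFun := fun k => ⟨t + 1 + k, Nat.le_add_right _ _⟩
      invFun := fun j => j - (t + 1)
      left_inv := fun k => Nat.add_sub_cancel_left ..
      right_inv := fun j => Subtype.ext (Nat.add_sub_cancel' j.2) }
  rw [← e.hasSum_iff]
  convert hv.hasSum hD hP hw (t + 1) using 2 with k
  change (_ ^ (t + 1 + k - t) * _ * _) *ᵥ w (t + 1 + k) = _
  rw [show t + 1 + k - t = k + 1 by omega]

end LQRData

theorem Memℓp.sqSummable {n : ℕ} {w : ℕ → Fin n → ℝ}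
    (hw : Memℓp (fun t => WithLp.toLp 2 (w t)) 2) : SqSummable w := by
  have h := (memℓp_gen_iff (by norm_num)).mp hw
  refine Summable.of_nonneg_of_le (fun _ => by positivity) (fun t => ?_) h
  rw [ENNReal.toReal_ofNat, Real.rpow_ofNat]
  gcongr
  exact (pi_norm_le_iff_of_nonneg (norm_nonneg _)).mpr fun i =>
    PiLp.norm_apply_le (WithLp.toLp 2 (w t)) i

end

theorem mainTheorem4 {nx nu nw : ℕ} (D : LQRData nx nu nw) (hD : D.Standing)
    (P : Matrix (Fin nx) (Fin nx) ℝ) (hP : D.IsDARESolution P)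
    (w : ℕ → Fin nw → ℝ) (hw : Memℓp (fun t => WithLp.toLp 2 (w t)) 2) :
    (∃! v : ℕ → Fin nx → ℝ, D.IsNoncausalSignal P w v) ∧
    ∀ v : ℕ → Fin nx → ℝ, D.IsNoncausalSignal P w v →
      -- closed form of the noncausal preview signal
      (∀ t : ℕ, HasSum
        (fun j : Set.Ici (t + 1) => ((D.Ahat P)ᵀ ^ ((j : ℕ) - t) * P * D.Bw) *ᵥ w j)
        (v (t + 1))) ∧
      -- the resulting controller stabilizes the plant and is the optimal noncausal controller
      D.IsStabilizing w (D.feedback P w v) ∧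
      (∀ x₀ : Fin nx → ℝ,
        D.cost w x₀ (D.feedback P w v) ≠ ⊤ ∧
        ∀ K : LQRData.Policy nx nu,
          D.cost w x₀ (D.feedback P w v) ≤ D.cost w x₀ K ∧
          (D.cost w x₀ K = D.cost w x₀ (D.feedback P w v) →
            D.input w x₀ K = D.input w x₀ (D.feedback P w v))) ∧
      -- uniform convergence of the finite preview control
      (∀ x₀ : Fin nx → ℝ, ∀ ε : ℝ, 0 < ε → ∃ N : ℕ, ∀ p : ℕ, N ≤ p → ∀ t : ℕ,
        ‖WithLp.toLp 2 (D.input w x₀ (D.feedback P w v) t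
          - D.input w x₀ (D.feedback P w (D.previewSignal P w p)) t)‖ < ε) := by
  have hw' := hw.sqSummable
  obtain ⟨v₀, hv₀⟩ := LQRData.exists_isNoncausalSignal hD hP hw'
  refine ⟨⟨v₀, hv₀, fun v hv => hv.unique hD hP hw' hv₀⟩, fun v hv => ⟨hv.hasSum_Ici hD hP hw',
    LQRData.isStabilizing_feedback hD hP hw' hv, fun x₀ =>
      ⟨LQRData.cost_feedback_ne_top hD hP hw' hv x₀, fun K =>
        ⟨LQRData.cost_feedback_le hD hP hw' hv x₀ K, LQRData.input_eq_of_cost_eq hD hP hw' hv⟩⟩,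
    fun x₀ ε hε => LQRData.exists_forall_norm_input_sub_lt hD hP hv x₀ hε⟩⟩
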